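/- Let $X$ be a compact metric space with metric $d$ and let $T:X\to X$ be continuous. For $n\ge 1$ put $d_n(x,y)=\max_{0\le k<n} d(T^kx,T^ky)$, and let $B_n(x,\varepsilon)$ and $\overline B_n(x,\varepsilon)$ be the open and closed $d_n$-balls. *Packing entropy.* For $Z\subset X$, $s\ge 0$, $\varepsilon>0$ let $$P^s_{N,\varepsilon}(Z)=\sup\sum_i e^{-sn_i},\qquad P^s_\varepsilon(Z)=\lim_{N\to\infty}P^s_{N,\varepsilon}(Z),\qquad \mathcal P^s_\varepsilon(Z)=\inf\Big\{\sum_{i=1}^\infty P^s_\varepsilon(Z_i): Z\subset\bigcup_{i=1}^\infty Z_i\Big\},$$ where the supremum is over all countable pairwise disjoint families $\{\overline B_{n_i}(x_i,\varepsilon)\}_i$ with $x_i\in Z$ and $n_i\ge N$ (with value $0$ for $Z=\emptyset$). Let $h^P_{\mathrm{top}}(T,Z,\varepsilon)\in[0,\infty]$ be the critical value of $s$ at which $\mathcal P^s_\varepsilon(Z)$ jumps from $\infty$ to $0$, and let $h^P_{\mathrm{top}}(T,Z)=\sup_{\varepsilon>0}h^P_{\mathrm{top}}(T,Z,\varepsilon)$.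 *Measures of maximal packing entropy.* For a Borel probability measure $\mu$ on $X$ let $$\overline h_\mu(T)=\int_X \lim_{\varepsilon\to0}\limsup_{n\to\infty}-\tfrac1n\log\mu(B_n(x,\varepsilon))\,d\mu(x)\in[0,\infty].$$ A set $Z$ has a measure of maximal packing entropy if there is a Borel probability measure $\mu$ on $X$ with $\mu(Z)=1$ and $\overline h_\mu(T)=h^P_{\mathrm{top}}(T,Z)>0$. *Increasing countable slices.* A set is analytic if it is empty or a continuous image of $\mathbb N^{\mathbb N}$. An analytic set $Z\subset X$ has an increasing countable slice of packing entropy if $Z=\bigcup_{i\in\mathbb N}Z_i$ for some analytic sets $Z_i$ with $h^P_{\mathrm{top}}(T,Z_i)<h^P_{\mathrm{top}}(T,Z)$ for all $i$. *$h$-expansiveness.* For $Y\subset X$ let $r_n(\delta,Y)$ be the least cardinality of a set $E\subset X$ such that every $x\in Y$ has some $y\in E$ with $d_n(x,y)\le\delta$, and let $h_{\mathrm{top}}(T,Y)=\lim_{\delta\to0}\limsup_{n\to\infty}\frac1n\log r_n(\delta,Y)$. The system $(X,T)$ is $h$-expansive if there is $\varepsilon>0$ such that $h_{\mathrm{top}}(T,\Phi_\varepsilon(x))=0$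 for every $x\in X$, where $\Phi_\varepsilon(x)=\{y\in X: d(T^iy,T^ix)\le\varepsilon\text{ for all } i\ge 0\}$. **Theorem.** Let $Z\subset X$ be an analytic set with $h^P_{\mathrm{top}}(T,Z)>0$. Consider: (1) $Z$ has a measure of maximal packing entropy; (2) $Z$ has no increasing countable slice of packing entropy. If $h^P_{\mathrm{top}}(T,Z)<\infty$, then (1) implies (2). If $(X,T)$ is $h$-expansive, then (1) and (2) are equivalent (with no finiteness hypothesis). -/

import Mathlib

open MeasureTheory Filter Set
open scoped ENNReal NNReal

noncomputable section

/-! Throughout, `X` is a (compact) metric space and `T : X → X` a (continuous) self-map. The `n`-th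
Bowen metric is `d_n(x, y) = max {d(T^k x, T^k y) : 0 ≤ k < n}`. All entropies are valued in
`[0, ∞]`. -/

/-- The open ball of radius `ε > 0` centred at `x` for the `n`-th Bowen metric. -/
def bowenBall {X : Type*} [MetricSpace X] (T : X → X) (n : ℕ) (x : X) (ε : ℝ) : Set X :=
  {y | ∀ k < n, dist (T^[k] x) (T^[k] y) < ε}

/-- The closed ball of radius `ε > 0` centred at `x` for the `n`-th Bowen metric. -/
def closedBowenBall {X : Type*} [MetricSpace X] (T : X → X) (n : ℕ) (x : X) (ε : ℝ) : Set X :=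
  {y | ∀ k < n, dist (T^[k] x) (T^[k] y) ≤ ε}

/-- `C` is the set of pairs `(x_i, n_i)` of a countable pairwise disjoint family of closed Bowen
balls of radius `ε` whose centres `x_i` lie in `Z` and whose orders satisfy `n_i ≥ N`. (The balls
are nonempty, so distinct members of a disjoint family have distinct pairs.) -/
def IsBowenPacking {X : Type*} [MetricSpace X] (T : X → X) (Z : Set X) (N : ℕ) (ε : ℝ)
    (C : Set (X × ℕ)) : Prop :=
  C.Countable ∧ (∀ p ∈ C, p.1 ∈ Z ∧ N ≤ p.2) ∧
    C.PairwiseDisjoint (fun p => closedBowenBall T p.2 p.1 ε)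

/-- `P^s_{N,ε}(Z)`: the supremum of `∑ exp (-s n_i)` over the packings above. -/
def packingSum {X : Type*} [MetricSpace X] (T : X → X) (Z : Set X) (s : ℝ≥0) (N : ℕ) (ε : ℝ) :
    ℝ≥0∞ :=
  ⨆ (C : Set (X × ℕ)) (_ : IsBowenPacking T Z N ε C),
    ∑' p : C, ENNReal.ofReal (Real.exp (-(s : ℝ) * ((p : X × ℕ).2 : ℝ)))

/-- `P^s_ε(Z)`: the limit, equivalently the infimum, of `P^s_{N,ε}(Z)` over `N`. -/
def packingPremeasure {X : Type*} [MetricSpace X] (T : X → X) (Z : Set X) (s : ℝ≥0) (ε : ℝ) :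
    ℝ≥0∞ :=
  ⨅ N : ℕ, packingSum T Z s N ε

/-- `𝒫^s_ε(Z)`: the infimum of `∑ P^s_ε(Z_i)` over all countable covers of `Z`. -/
def packingMeasure {X : Type*} [MetricSpace X] (T : X → X) (Z : Set X) (s : ℝ≥0) (ε : ℝ) :
    ℝ≥0∞ :=
  ⨅ (W : ℕ → Set X) (_ : Z ⊆ ⋃ i, W i), ∑' i, packingPremeasure T (W i) s ε

/-- `h^P_top(T, Z, ε)`: the critical value of `s` at which `𝒫^s_ε(Z)` jumps from `∞` to `0` (and
`∞` if it never vanishes); see `packingMeasure_eq_zero_of_gt` and `packingMeasure_eq_top_of_lt`. -/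
def packingEntropyAt {X : Type*} [MetricSpace X] (T : X → X) (Z : Set X) (ε : ℝ) : ℝ≥0∞ :=
  ⨅ (s : ℝ≥0) (_ : packingMeasure T Z s ε = 0), (s : ℝ≥0∞)

/-- The packing topological entropy `h^P_top(T, Z)`: the limit as `ε → 0`, equivalently the
supremum over `ε > 0`, of `h^P_top(T, Z, ε)`. -/
def packingEntropy {X : Type*} [MetricSpace X] (T : X → X) (Z : Set X) : ℝ≥0∞ :=
  ⨆ (ε : ℝ) (_ : 0 < ε), packingEntropyAt T Z ε

/-- The local upper entropy `limsup_n -(1/n) log μ(B_n(x, ε))` at scale `ε` of a probability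
measure `μ`; here `-log μ(B) ∈ [0, ∞]`, with value `∞` when `μ(B) = 0`. -/
def localUpperEntropyAt {X : Type*} [MetricSpace X] [MeasurableSpace X] (T : X → X)
    (μ : Measure X) (x : X) (ε : ℝ) : ℝ≥0∞ :=
  limsup (fun n : ℕ => (-ENNReal.log (μ (bowenBall T n x ε))).toENNReal / (n : ℝ≥0∞)) atTop

/-- The local upper entropy at `x`: the limit as `ε → 0`, equivalently the supremum over `ε > 0`. -/
def localUpperEntropy {X : Type*} [MetricSpace X] [MeasurableSpace X] (T : X → X)
    (μ : Measure X) (x : X) : ℝ≥0∞ :=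
  ⨆ (ε : ℝ) (_ : 0 < ε), localUpperEntropyAt T μ x ε

/-- The measure-theoretical upper entropy of `μ`: the integral of the local upper entropy. -/
def upperEntropy {X : Type*} [MetricSpace X] [MeasurableSpace X] (T : X → X)
    (μ : Measure X) : ℝ≥0∞ :=
  ∫⁻ x, localUpperEntropy T μ x ∂μ

/-- `Z` has a Borel probability measure of maximal packing entropy. -/
def HasMaxPackingEntropyMeasure {X : Type*} [MetricSpace X] [MeasurableSpace X] (T : X → X)
    (Z : Set X) : Prop :=
  ∃ μ : Measure X, IsProbabilityMeasure μ ∧ μ Z = 1 ∧ upperEntropy T μ = packingEntropy T Z ∧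
    0 < packingEntropy T Z

/-- `Z` has an increasing countable slice of packing entropy: it is a countable union of analytic
sets of strictly smaller packing entropy. -/
def HasIncreasingCountableSlice {X : Type*} [MetricSpace X] (T : X → X) (Z : Set X) : Prop :=
  ∃ W : ℕ → Set X, (∀ i, AnalyticSet (W i)) ∧ Z = ⋃ i, W i ∧
    ∀ i, packingEntropy T (W i) < packingEntropy T Z

/-- `Φ_ε(x)`: the set of points whose forward orbit stays within distance `ε` of that of `x`. -/
def shadowSet {X : Type*} [MetricSpace X] (T : X → X) (ε : ℝ) (x : X) : Set X :=
  ⋂ i : ℕ, T^[i] ⁻¹' Metric.closedBall (T^[i] x) ε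

/-- `h*_T(ε) = sup_x h_top(T, Φ_ε(x))`, where `h_top(T, Y)` is the topological entropy of a subset,
defined by spanning sets (`Dynamics.coverEntropy`). The latter is nonnegative for nonempty `Y`. -/
def hStar {X : Type*} [MetricSpace X] (T : X → X) (ε : ℝ) : ℝ≥0∞ :=
  ⨆ x : X, (Dynamics.coverEntropy T (shadowSet T ε x)).toENNReal

/-- `(X, T)` is `h`-expansive. -/
def IsHExpansive {X : Type*} [MetricSpace X] (T : X → X) : Prop :=
  ∃ ε : ℝ, 0 < ε ∧ hStar T ε = 0

/-! The jump of `𝒫^s_ε(Z)` at the critical value. -/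

theorem packingSum_le_of_le {X : Type*} [MetricSpace X] (T : X → X) (Z : Set X) {s t : ℝ≥0}
    (hst : s ≤ t) (N : ℕ) (ε : ℝ) :
    packingSum T Z t N ε ≤
      ENNReal.ofReal (Real.exp (-((t : ℝ) - s) * N)) * packingSum T Z s N ε := by
  refine iSup₂_le fun C hC => ?_
  calc ∑' p : C, ENNReal.ofReal (Real.exp (-(t : ℝ) * ((p : X × ℕ).2 : ℝ)))
      ≤ ∑' p : C, ENNReal.ofReal (Real.exp (-((t : ℝ) - s) * N)) *
          ENNReal.ofReal (Real.exp (-(s : ℝ) * ((p : X × ℕ).2 : ℝ))) := by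
        refine ENNReal.tsum_le_tsum fun p => ?_
        rw [← ENNReal.ofReal_mul (Real.exp_pos _).le, ← Real.exp_add]
        refine ENNReal.ofReal_le_ofReal (Real.exp_le_exp.2 ?_)
        have h1 : (N : ℝ) ≤ ((p : X × ℕ).2 : ℝ) := by exact_mod_cast (hC.2.1 p p.2).2
        have h2 : (s : ℝ) ≤ t := by exact_mod_cast hst
        nlinarith [mul_nonneg (sub_nonneg.2 h2) (sub_nonneg.2 h1)]
    _ = ENNReal.ofReal (Real.exp (-((t : ℝ) - s) * N)) *
          ∑' p : C, ENNReal.ofReal (Real.exp (-(s : ℝ) * ((p : X × ℕ).2 : ℝ))) :=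
        ENNReal.tsum_mul_left
    _ ≤ _ := by
        gcongr
        exact le_iSup₂_of_le C hC le_rfl

theorem packingSum_anti {X : Type*} [MetricSpace X] (T : X → X) (Z : Set X) (s : ℝ≥0)
    (ε : ℝ) : Antitone fun N => packingSum T Z s N ε := by
  intro M N hMN
  refine iSup₂_le fun C hC => ?_
  exact le_iSup₂_of_le (f := fun (C : Set (X × ℕ)) (_ : IsBowenPacking T Z M ε C) =>
    ∑' p : C, ENNReal.ofReal (Real.exp (-(s : ℝ) * ((p : X × ℕ).2 : ℝ)))) C
    ⟨hC.1, fun p hp => ⟨(hC.2.1 p hp).1, hMN.trans (hC.2.1 p hp).2⟩, hC.2.2⟩ le_rfl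

theorem packingPremeasure_eq_zero {X : Type*} [MetricSpace X] (T : X → X) (Z : Set X)
    {s t : ℝ≥0} (hst : s < t) (ε : ℝ) (h : packingPremeasure T Z s ε ≠ ⊤) :
    packingPremeasure T Z t ε = 0 := by
  obtain ⟨M, hM⟩ : ∃ M, packingSum T Z s M ε ≠ ⊤ := by
    by_contra! hc
    exact h (by simp [packingPremeasure, hc])
  have hlim : Tendsto (fun N : ℕ => ENNReal.ofReal (Real.exp (-((t : ℝ) - s) * N)) *
      packingSum T Z s M ε) atTop (nhds 0) := by
    have hpos : (0 : ℝ) < (t : ℝ) - s := sub_pos.2 (by exact_mod_cast hst)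
    have h1 : Tendsto (fun N : ℕ => Real.exp (-((t : ℝ) - s) * N)) atTop (nhds 0) := by
      refine Real.tendsto_exp_atBot.comp ?_
      exact (tendsto_natCast_atTop_atTop (R := ℝ)).const_mul_atTop_of_neg (by linarith)
    have h2 := ENNReal.Tendsto.mul_const (b := packingSum T Z s M ε)
      (ENNReal.tendsto_ofReal h1) (Or.inr hM)
    simpa using h2
  refine le_antisymm (ge_of_tendsto hlim ?_) zero_le
  filter_upwards [eventually_ge_atTop M] with N hN
  refine (iInf_le _ N).trans ((packingSum_le_of_le T Z hst.le N ε).trans ?_)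
  gcongr
  exact packingSum_anti T Z s ε hN

theorem packingMeasure_eq_zero {X : Type*} [MetricSpace X] (T : X → X) (Z : Set X)
    {s t : ℝ≥0} (hst : s < t) (ε : ℝ) (h : packingMeasure T Z s ε ≠ ⊤) :
    packingMeasure T Z t ε = 0 := by
  obtain ⟨W, hW, hs⟩ : ∃ W : ℕ → Set X, Z ⊆ ⋃ i, W i ∧
      ∑' i, packingPremeasure T (W i) s ε ≠ ⊤ := by
    by_contra! hc
    exact h (by simp only [packingMeasure, iInf_eq_top]; exact hc)
  refine le_antisymm ((iInf₂_le W hW).trans (le_of_eq ?_)) zero_le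
  exact ENNReal.tsum_eq_zero.2 fun i =>
    packingPremeasure_eq_zero T (W i) hst ε (ENNReal.ne_top_of_tsum_ne_top hs i)

theorem packingMeasure_eq_zero_of_gt {X : Type*} [MetricSpace X] (T : X → X) (Z : Set X)
    (ε : ℝ) (s : ℝ≥0) (hs : packingEntropyAt T Z ε < s) : packingMeasure T Z s ε = 0 := by
  simp only [packingEntropyAt, iInf_lt_iff] at hs
  obtain ⟨r, hr, hrs⟩ := hs
  exact packingMeasure_eq_zero T Z (by exact_mod_cast hrs) ε (by simp [hr])

theorem packingMeasure_eq_top_of_lt {X : Type*} [MetricSpace X] (T : X → X) (Z : Set X)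
    (ε : ℝ) (s : ℝ≥0) (hs : s < packingEntropyAt T Z ε) : packingMeasure T Z s ε = ⊤ := by
  by_contra hne
  obtain ⟨t, hst, hts⟩ := ENNReal.lt_iff_exists_nnreal_btwn.1 hs
  have h0 := packingMeasure_eq_zero T Z (t := t) (by exact_mod_cast hst) ε hne
  exact absurd (iInf₂_le t h0) (not_le.2 hts)

end

/-!
Packings are replaced by growth rates at a single time. A set `W` satisfies `PackingGrowth T W s
δ` when its families of disjoint closed Bowen balls of order `n` and radius `δ` have `O(exp (s
n))` members, and `h^P_top(T, Z, δ)` is the infimum of the `s` for which `Z` is a countable union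
of such sets (`exists_cover_packingGrowth`, `packingEntropyAt_le_of_cover`), just as packing
dimension is a modified upper box dimension.

A maximal disjoint family covers once its radius is doubled. With the Borel–Cantelli lemma this
gives that, for any measure, the local upper entropy is at most `h^P_top(T, Z)` at almost every
point of `Z` (`measure_packingEntropy_lt_localUpperEntropy`). So if `Z` is a countable union of
sets of entropy less than `h^P_top(T, Z) < ∞`, the local upper entropy of a measure carried by `Z`
is almost everywhere less than `h^P_top(T, Z)`, and so is its integral.

For the converse, Bowen's covering estimate for `h`-expansive systems
(`exists_hasBowenColoring_closedBowenBall`) shows that there is a scale `δ` with `h^P_top(T, A) =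
h^P_top(T, A, δ) < ∞` for every set `A`. Parametrize `Z` continuously by `ℕ → ℕ` and discard the
basic open sets whose images lie in the `σ`-ideal generated by the analytic subsets of `Z` of
smaller entropy. If `Z` has no increasing countable slice, a nonempty closed set `Y` remains, and
all nonempty open subsets of `Y` have images of full entropy at scale `δ`
(`exists_parametrization_packingEntropy_le`). For any sequence of rates `s p` increasing to
`h^P_top(T, Z)`, each point of `Y` may thus be replaced by at least `exp (s p * n)` nearby points
whose images are `δ`-separated by a large time `n`. Iterating yields a tree of balls in `Y`, and
following a random path in it gives a random point of `Z` (`exists_measure_le_localUpperEntropy`)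
whose law has local upper entropy at least every `s p`, hence at least `h^P_top(T, Z)`, everywhere
on the image of the paths. Since the scale `δ` is fixed, the rates can be taken all the way up to
`h^P_top(T, Z)`.
-/

/-! ### Exponential growth of packings -/

/-- Families of points of `W` whose closed Bowen balls of order `n` and radius `δ` are pairwise
disjoint have cardinality `O(exp (s n))`: the sets of upper capacity entropy at most `s`, at scale
`δ`. -/
def PackingGrowth {X : Type*} [MetricSpace X] (T : X → X) (W : Set X) (s : ℝ≥0) (δ : ℝ) : Prop :=
  ∃ (K : ℝ) (N : ℕ), ∀ n ≥ N, ∀ F : Finset X, (F : Set X) ⊆ W →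
    (F : Set X).PairwiseDisjoint (fun x => closedBowenBall T n x δ) →
    (F.card : ℝ) ≤ K * Real.exp (s * n)

section Growth

variable {X : Type*} [MetricSpace X] {T : X → X} {W Z : Set X} {s t : ℝ≥0} {δ : ℝ} {n : ℕ}

theorem bowenBall_mono (x : X) {a b : ℝ} (h : a ≤ b) : bowenBall T n x a ⊆ bowenBall T n x b :=
  fun _ hy k hk => (hy k hk).trans_le h

theorem PackingGrowth.of_packingPremeasure_ne_top (h : packingPremeasure T W s δ ≠ ⊤) :
    PackingGrowth T W s δ := by
  classical
  obtain ⟨N, hN⟩ : ∃ N, packingSum T W s N δ ≠ ⊤ := by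
    by_contra! hc
    exact h (by simp [packingPremeasure, hc])
  refine ⟨(packingSum T W s N δ).toReal, N, fun n hn F hF hd => ?_⟩
  set C : Finset (X × ℕ) := F.image fun x => (x, n) with hC
  have hpack : IsBowenPacking T W N δ (C : Set (X × ℕ)) := by
    refine ⟨C.countable_toSet, ?_, ?_⟩
    · intro p hp
      obtain ⟨x, hx, rfl⟩ := Finset.mem_image.1 (Finset.mem_coe.1 hp)
      exact ⟨hF hx, hn⟩
    · intro p hp q hq hpq
      obtain ⟨x, hx, rfl⟩ := Finset.mem_image.1 (Finset.mem_coe.1 hp)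
      obtain ⟨y, hy, rfl⟩ := Finset.mem_image.1 (Finset.mem_coe.1 hq)
      exact hd hx hy fun hxy => hpq (by rw [hxy])
  have h1 : ∑' p : (C : Set (X × ℕ)),
      ENNReal.ofReal (Real.exp (-(s : ℝ) * ((p : X × ℕ).2 : ℝ))) ≤ packingSum T W s N δ :=
    le_iSup₂_of_le (f := fun (C : Set (X × ℕ)) (_ : IsBowenPacking T W N δ C) =>
      ∑' p : C, ENNReal.ofReal (Real.exp (-(s : ℝ) * ((p : X × ℕ).2 : ℝ)))) _ hpack le_rfl
  rw [Finset.tsum_subtype' C fun p : X × ℕ => ENNReal.ofReal (Real.exp (-(s : ℝ) * (p.2 : ℝ))),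
    hC, Finset.sum_image (fun x _ y _ hxy => (Prod.mk.inj hxy).1)] at h1
  simp only [Finset.sum_const, nsmul_eq_mul] at h1
  have h2 := ENNReal.toReal_mono hN h1
  rw [ENNReal.toReal_mul, ENNReal.toReal_ofReal (Real.exp_pos _).le, ENNReal.toReal_natCast] at h2
  calc (F.card : ℝ) = F.card * Real.exp (-(s : ℝ) * n) * Real.exp (s * n) := by
        rw [mul_assoc, ← Real.exp_add]; simp
    _ ≤ _ := by gcongr

theorem summable_exp_neg_mul_nat {c : ℝ} (hc : c < 0) (K : ℝ) :
    Summable fun n : ℕ => K * Real.exp (c * n) := by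
  refine Summable.mul_left K ?_
  have := Real.summable_exp_nat_mul_of_ge (c := c) hc (f := fun n => (n : ℝ)) (fun _ => le_rfl)
  simpa using this

theorem PackingGrowth.packingPremeasure_ne_top (h : PackingGrowth T W s δ) (hst : s < t) :
    packingPremeasure T W t δ ≠ ⊤ := by
  classical
  obtain ⟨K, N, hK⟩ := h
  have hc : (s : ℝ) - t < 0 := sub_neg.2 (by exact_mod_cast hst)
  have hfin := (summable_exp_neg_mul_nat hc K).tsum_ofReal_ne_top
  refine ne_top_of_le_ne_top hfin ((iInf_le _ N).trans (iSup₂_le fun C hC => ?_))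
  rw [ENNReal.tsum_eq_iSup_sum]
  refine iSup_le fun S => ?_
  -- group the members of the packing by their order `n`
  rw [← Finset.sum_fiberwise_of_maps_to (t := S.image fun p : C => (p : X × ℕ).2)
    (g := fun p : C => (p : X × ℕ).2) (fun p hp => Finset.mem_image_of_mem _ hp)]
  refine le_trans (Finset.sum_le_sum fun n hn => ?_) (ENNReal.sum_le_tsum _)
  obtain ⟨p₀, -, hp₀⟩ := Finset.mem_image.1 hn
  set R := S.filter fun p : C => (p : X × ℕ).2 = n with hR
  have hinj : Set.InjOn (fun p : C => (p : X × ℕ).1) R := by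
    intro p hp q hq hpq
    refine Subtype.ext (Prod.ext hpq ?_)
    rw [(Finset.mem_filter.1 hp).2, (Finset.mem_filter.1 hq).2]
  have hcard : (R.card : ℝ) ≤ K * Real.exp (s * n) := by
    rw [← Finset.card_image_of_injOn hinj]
    refine hK n (hp₀ ▸ (hC.2.1 p₀ p₀.2).2) _ ?_ ?_
    · intro x hx
      obtain ⟨p, -, rfl⟩ := Finset.mem_image.1 (Finset.mem_coe.1 hx)
      exact (hC.2.1 p p.2).1
    · intro x hx y hy hxy
      obtain ⟨p, hp, rfl⟩ := Finset.mem_image.1 (Finset.mem_coe.1 hx)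
      obtain ⟨q, hq, rfl⟩ := Finset.mem_image.1 (Finset.mem_coe.1 hy)
      have := hC.2.2 p.2 q.2 fun hpq => hxy (by rw [hpq])
      simpa only [Function.onFun, (Finset.mem_filter.1 hp).2, (Finset.mem_filter.1 hq).2] using this
  calc ∑ p ∈ R, ENNReal.ofReal (Real.exp (-(t : ℝ) * ((p : X × ℕ).2 : ℝ)))
      = ∑ p ∈ R, ENNReal.ofReal (Real.exp (-(t : ℝ) * (n : ℝ))) :=
        Finset.sum_congr rfl fun p hp => by rw [(Finset.mem_filter.1 hp).2]
    _ = ENNReal.ofReal (R.card * Real.exp (-(t : ℝ) * n)) := by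
        rw [Finset.sum_const, nsmul_eq_mul, ENNReal.ofReal_mul (by positivity),
          ENNReal.ofReal_natCast]
    _ ≤ _ := by
        refine ENNReal.ofReal_le_ofReal ?_
        calc R.card * Real.exp (-(t : ℝ) * n)
            ≤ K * Real.exp (s * n) * Real.exp (-(t : ℝ) * n) := by gcongr
          _ = K * Real.exp (((s : ℝ) - t) * n) := by
              rw [mul_assoc, ← Real.exp_add]; ring_nf

theorem exists_cover_packingGrowth (h : packingEntropyAt T Z δ < s) :
    ∃ W : ℕ → Set X, Z ⊆ ⋃ i, W i ∧ ∀ i, PackingGrowth T (W i) s δ := by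
  have h0 := packingMeasure_eq_zero_of_gt T Z δ s h
  obtain ⟨W, hW, hs⟩ : ∃ W : ℕ → Set X, Z ⊆ ⋃ i, W i ∧
      ∑' i, packingPremeasure T (W i) s δ ≠ ⊤ := by
    by_contra! hc
    have : packingMeasure T Z s δ = ⊤ := by simp only [packingMeasure, iInf_eq_top]; exact hc
    simp [this] at h0
  exact ⟨W, hW, fun i => .of_packingPremeasure_ne_top (ENNReal.ne_top_of_tsum_ne_top hs i)⟩

theorem packingEntropyAt_le_of_cover {W : ℕ → Set X} (hW : Z ⊆ ⋃ i, W i)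
    (h : ∀ i, PackingGrowth T (W i) s δ) : packingEntropyAt T Z δ ≤ s := by
  refine le_of_forall_gt_imp_ge_of_dense fun b hb => ?_
  obtain ⟨u, hsu, hub⟩ := ENNReal.lt_iff_exists_nnreal_btwn.1 hb
  obtain ⟨r, hsr, hru⟩ := exists_between (ENNReal.coe_lt_coe.1 hsu)
  refine le_trans (iInf₂_le u ?_) hub.le
  refine le_antisymm ((iInf₂_le W hW).trans (le_of_eq ?_)) zero_le
  exact ENNReal.tsum_eq_zero.2 fun i =>
    packingPremeasure_eq_zero T (W i) hru δ ((h i).packingPremeasure_ne_top hsr)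

theorem packingEntropyAt_le_packingEntropy (hδ : 0 < δ) :
    packingEntropyAt T Z δ ≤ packingEntropy T Z :=
  le_iSup₂_of_le (f := fun (ε : ℝ) (_ : 0 < ε) => packingEntropyAt T Z ε) δ hδ le_rfl

theorem packingEntropy_empty : packingEntropy T (∅ : Set X) = 0 := by
  refine le_antisymm (iSup₂_le fun ε _ => ?_) zero_le
  refine packingEntropyAt_le_of_cover (s := 0) (W := fun _ => ∅) (empty_subset _) fun _ =>
    ⟨0, 0, fun n _ F hF _ => ?_⟩
  simp [Finset.coe_eq_empty.1 (subset_empty_iff.1 hF)]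

/-- A maximal family of disjoint balls of radius `δ` covers once the radius is doubled. -/
theorem exists_finset_cover_closedBowenBall (hδ : 0 ≤ δ) {B : ℕ}
    (hB : ∀ F : Finset X, (F : Set X) ⊆ W →
      (F : Set X).PairwiseDisjoint (fun x => closedBowenBall T n x δ) → F.card ≤ B) :
    ∃ F : Finset X, (F : Set X) ⊆ W ∧
      (F : Set X).PairwiseDisjoint (fun x => closedBowenBall T n x δ) ∧
      W ⊆ ⋃ x ∈ F, closedBowenBall T n x (2 * δ) := by
  classical
  let P : ℕ → Prop := fun k => ∃ F : Finset X, ((F : Set X) ⊆ W ∧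
      (F : Set X).PairwiseDisjoint (fun x => closedBowenBall T n x δ)) ∧ F.card = k
  have hP0 : P 0 := ⟨∅, by simp, rfl⟩
  obtain ⟨F, ⟨hFW, hFd⟩, hFc⟩ := Nat.findGreatest_spec (P := P) (Nat.zero_le B) hP0
  refine ⟨F, hFW, hFd, fun w hw => ?_⟩
  by_contra hnot
  simp only [mem_iUnion, not_exists] at hnot
  have hwF : w ∉ F := fun hwF => hnot w hwF fun k _ => by simp; positivity
  have hins : P (F.card + 1) := by
    refine ⟨insert w F, ⟨?_, ?_⟩, Finset.card_insert_of_notMem hwF⟩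
    · simpa [insert_subset_iff] using ⟨hw, hFW⟩
    · rw [Finset.coe_insert]
      refine hFd.insert fun x hx _ => disjoint_left.2 fun y hy hy' => hnot x hx fun k hk => ?_
      have h1 := hy k hk
      have h2 := hy' k hk
      have h3 := dist_triangle_right (T^[k] x) (T^[k] w) (T^[k] y)
      linarith
  have hle : F.card + 1 ≤ B := by
    obtain ⟨G, ⟨hG1, hG2⟩, hG⟩ := hins
    exact hG ▸ hB G hG1 hG2
  have := Nat.le_findGreatest hle hins
  omega

end Growth

/-! ### Local upper entropy -/

section Local

variable {X : Type*} [MetricSpace X] [MeasurableSpace X] {T : X → X}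

theorem log_ofReal_exp (r : ℝ) : ENNReal.log (ENNReal.ofReal (Real.exp r)) = r := by
  rw [ENNReal.log_ofReal_of_pos (Real.exp_pos r), Real.log_exp]

theorem lt_toENNReal_neg_log {c : ℝ≥0} {m : ℝ≥0∞} :
    (c : ℝ≥0∞) < (-ENNReal.log m).toENNReal ↔ m < ENNReal.ofReal (Real.exp (-c)) := by
  rw [← ENNReal.log_lt_log_iff (x := m), log_ofReal_exp, ← not_le, ← not_le, not_iff_not,
    ← EReal.coe_ennreal_le_coe_ennreal_iff]
  rw [EReal.coe_neg, EReal.neg_le]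
  have : (((c : ℝ≥0∞)) : EReal) = ((c : ℝ) : EReal) := rfl
  rw [this]
  rw [EReal.coe_toENNReal_eq_max, max_le_iff]
  exact ⟨fun h => h.2, fun h => ⟨by exact_mod_cast c.2, h⟩⟩

theorem localUpperEntropyAt_anti (μ : Measure X) (x : X) :
    Antitone (localUpperEntropyAt T μ x) := by
  intro a b hab
  refine limsup_le_limsup (Eventually.of_forall fun n => ?_)
  refine ENNReal.div_le_div_right (EReal.toENNReal_le_toENNReal (EReal.neg_le_neg_iff.2 ?_)) _
  exact ENNReal.log_monotone (measure_mono (bowenBall_mono x hab))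

theorem localUpperEntropy_eq_iSup_nat (μ : Measure X) (x : X) :
    localUpperEntropy T μ x = ⨆ k : ℕ, localUpperEntropyAt T μ x (1 / ((k : ℝ) + 1)) := by
  refine le_antisymm (iSup₂_le fun ε hε => ?_) (iSup_le fun k => ?_)
  · obtain ⟨k, hk⟩ := exists_nat_one_div_lt hε
    exact le_iSup_of_le k (localUpperEntropyAt_anti μ x hk.le)
  · exact le_iSup₂_of_le (f := fun (ε : ℝ) (_ : 0 < ε) => localUpperEntropyAt T μ x ε) _
      Nat.one_div_pos_of_nat le_rfl

theorem measurable_localUpperEntropy [SecondCountableTopology X] [BorelSpace X]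
    (hT : Continuous T) (μ : Measure X) [SFinite μ] : Measurable (localUpperEntropy T μ) := by
  have hball : ∀ (n : ℕ) (ε : ℝ), Measurable fun x => μ (bowenBall T n x ε) := by
    intro n ε
    have hopen : IsOpen {p : X × X | ∀ k < n, dist (T^[k] p.1) (T^[k] p.2) < ε} := by
      have : {p : X × X | ∀ k < n, dist (T^[k] p.1) (T^[k] p.2) < ε} =
          ⋂ k ∈ Finset.range n, {p : X × X | dist (T^[k] p.1) (T^[k] p.2) < ε} := by
        ext p; simp
      rw [this]
      refine isOpen_biInter_finset fun k _ => isOpen_lt ?_ continuous_const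
      exact ((hT.iterate k).comp continuous_fst).dist ((hT.iterate k).comp continuous_snd)
    exact measurable_measure_prodMk_left hopen.measurableSet
  have : localUpperEntropy T μ = fun x =>
      ⨆ k : ℕ, localUpperEntropyAt T μ x (1 / ((k : ℝ) + 1)) :=
    funext fun x => localUpperEntropy_eq_iSup_nat μ x
  rw [this]
  refine Measurable.iSup fun k => Measurable.limsup fun n => ?_
  exact ((hball n _).ennreal_log.neg.ereal_toENNReal).div_const _

/-- On a set on which packings grow at most like `exp (s n)`, almost no point has Bowen balls of
mass below `exp (-t n)` infinitely often, when `s < t`: for each `n` the points with a small ball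
are covered by `O(exp (s n))` such balls, so the Borel–Cantelli lemma applies. -/
theorem PackingGrowth.measure_frequently_lt_eq_zero {W : Set X} {s t : ℝ≥0} {δ : ℝ} (hδ : 0 < δ)
    (h : PackingGrowth T W s δ) (hst : s < t) (μ : Measure X) :
    μ {x | x ∈ W ∧ ∃ᶠ n : ℕ in atTop,
      μ (bowenBall T n x (3 * δ)) < ENNReal.ofReal (Real.exp (-(t : ℝ) * n))} = 0 := by
  obtain ⟨K, N, hK⟩ := h
  have hc : (s : ℝ) - t < 0 := sub_neg.2 (by exact_mod_cast hst)
  set V : ℕ → Set X := fun n => {x | (x ∈ W ∧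
    μ (bowenBall T n x (3 * δ)) < ENNReal.ofReal (Real.exp (-(t : ℝ) * n))) ∧ N ≤ n} with hV
  have hbound : ∀ n, μ (V n) ≤ ENNReal.ofReal (K * Real.exp (((s : ℝ) - t) * n)) := by
    intro n
    by_cases hn : N ≤ n
    swap
    · simp [hV, hn]
    have hVW : V n ⊆ W := fun x hx => hx.1.1
    obtain ⟨F, hF, hFd, hcov⟩ := exists_finset_cover_closedBowenBall (T := T) (n := n)
      (W := V n) hδ.le (B := ⌊K * Real.exp (s * n)⌋₊)
      fun F hF hFd => Nat.le_floor (hK n hn F (hF.trans hVW) hFd)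
    have hcov' : V n ⊆ ⋃ x ∈ F, bowenBall T n x (3 * δ) :=
      hcov.trans (iUnion₂_mono fun x _ y hy k hk => (hy k hk).trans_lt (by linarith))
    calc μ (V n) ≤ ∑ x ∈ F, μ (bowenBall T n x (3 * δ)) :=
          (measure_mono hcov').trans (measure_biUnion_finset_le _ _)
      _ ≤ ∑ x ∈ F, ENNReal.ofReal (Real.exp (-(t : ℝ) * n)) :=
          Finset.sum_le_sum fun x hx => (hF hx).1.2.le
      _ = ENNReal.ofReal (F.card * Real.exp (-(t : ℝ) * n)) := by
          rw [Finset.sum_const, nsmul_eq_mul, ENNReal.ofReal_mul (by positivity),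
            ENNReal.ofReal_natCast]
      _ ≤ _ := by
          refine ENNReal.ofReal_le_ofReal ?_
          calc F.card * Real.exp (-(t : ℝ) * n)
              ≤ K * Real.exp (s * n) * Real.exp (-(t : ℝ) * n) := by
                gcongr; exact hK n hn F (hF.trans hVW) hFd
            _ = K * Real.exp (((s : ℝ) - t) * n) := by
                rw [mul_assoc, ← Real.exp_add]; ring_nf
  have hsum : ∑' n, μ (V n) ≠ ⊤ :=
    ne_top_of_le_ne_top (summable_exp_neg_mul_nat hc K).tsum_ofReal_ne_top
      (ENNReal.tsum_le_tsum hbound)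
  refine measure_mono_null ?_ (measure_setOfPred_frequently_eq_zero (p := fun n x => x ∈ V n) hsum)
  rintro x ⟨hxW, hx⟩
  exact (hx.and_eventually (eventually_ge_atTop N)).mono fun n hn => ⟨⟨hxW, hn.1⟩, hn.2⟩

/-- The local upper entropy of a measure is at most `h^P_top(T, Z)` at almost every point of `Z`. -/
theorem measure_packingEntropy_lt_localUpperEntropy (T : X → X) (μ : Measure X) (Z : Set X) :
    μ {x | x ∈ Z ∧ packingEntropy T Z < localUpperEntropy T μ x} = 0 := by
  have hsub : {x | x ∈ Z ∧ packingEntropy T Z < localUpperEntropy T μ x} ⊆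
      ⋃ (k : ℕ) (q : ℚ), {x | x ∈ Z ∧ packingEntropy T Z < (Real.toNNReal q : ℝ≥0∞) ∧
        (Real.toNNReal q : ℝ≥0∞) < localUpperEntropyAt T μ x (1 / ((k : ℝ) + 1))} := by
    rintro x ⟨hx, hlt⟩
    rw [localUpperEntropy_eq_iSup_nat] at hlt
    obtain ⟨k, hk⟩ := lt_iSup_iff.1 hlt
    obtain ⟨q, -, h1, h2⟩ := ENNReal.lt_iff_exists_rat_btwn.1 hk
    exact mem_iUnion₂.2 ⟨k, q, hx, h1, h2⟩
  refine measure_mono_null hsub (measure_iUnion_null fun k => measure_iUnion_null fun q => ?_)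
  by_cases hq : packingEntropy T Z < (Real.toNNReal q : ℝ≥0∞)
  swap
  · simp [hq]
  obtain ⟨s, hs1, hs2⟩ := ENNReal.lt_iff_exists_nnreal_btwn.1 hq
  have hδ : (0 : ℝ) < 1 / ((k : ℝ) + 1) / 3 := by positivity
  obtain ⟨W, hW, hg⟩ := exists_cover_packingGrowth (s := s)
    ((packingEntropyAt_le_packingEntropy (T := T) (Z := Z) hδ).trans_lt hs1)
  refine measure_mono_null ?_ (measure_iUnion_null fun i =>
    (hg i).measure_frequently_lt_eq_zero hδ (ENNReal.coe_lt_coe.1 hs2) μ)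
  rintro x ⟨hxZ, -, hx⟩
  obtain ⟨i, hi⟩ := mem_iUnion.1 (hW hxZ)
  refine mem_iUnion.2 ⟨i, hi, ?_⟩
  refine ((frequently_lt_of_lt_limsup (by isBoundedDefault) hx).and_eventually
    (eventually_gt_atTop 0)).mono fun n hn => ?_
  have hn0 : (n : ℝ≥0∞) ≠ 0 := by exact_mod_cast hn.2.ne'
  have h1 := (ENNReal.lt_div_iff_mul_lt (Or.inl hn0) (Or.inl (ENNReal.natCast_ne_top n))).1 hn.1
  have h2 : ((Real.toNNReal q * n : ℝ≥0) : ℝ≥0∞) <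
      (-ENNReal.log (μ (bowenBall T n x (1 / ((k : ℝ) + 1))))).toENNReal := by
    simpa using h1
  rw [lt_toENNReal_neg_log] at h2
  have h3 : 3 * (1 / ((k : ℝ) + 1) / 3) = 1 / ((k : ℝ) + 1) := by ring
  rw [h3]
  simpa using h2

end Local

/-- An almost sure event of a set of full outer measure is almost sure. -/
theorem ae_of_measure_inter_eq_zero {X : Type*} [MeasurableSpace X] {μ : Measure X}
    [IsProbabilityMeasure μ] {Z : Set X} (hZ : μ Z = 1) {p : X → Prop}
    (hp : MeasurableSet {x | p x}) (h : μ {x | x ∈ Z ∧ ¬p x} = 0) : ∀ᵐ x ∂μ, p x := by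
  refine (mem_ae_iff_prob_eq_one hp).2 (le_antisymm prob_le_one ?_)
  calc (1 : ℝ≥0∞) = μ Z := hZ.symm
    _ ≤ μ ({x | x ∈ Z ∧ ¬p x} ∪ {x | p x}) := by
        refine measure_mono fun x hx => ?_
        by_cases hpx : p x
        exacts [Or.inr hpx, Or.inl ⟨hx, hpx⟩]
    _ ≤ 0 + μ {x | p x} := h ▸ measure_union_le _ _
    _ = _ := zero_add _

section MaxImpliesNoSlice

variable {X : Type*} [MetricSpace X] [SecondCountableTopology X] [MeasurableSpace X] [BorelSpace X]
  {T : X → X}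

/-- With finite entropy, the local upper entropy of a measure carried by an increasing countable
slice is almost everywhere strictly below `h^P_top(T, Z)`, so its integral is too. -/
theorem HasMaxPackingEntropyMeasure.not_hasIncreasingCountableSlice (hT : Continuous T) {Z : Set X}
    (hfin : packingEntropy T Z < ⊤) (h : HasMaxPackingEntropyMeasure T Z) :
    ¬ HasIncreasingCountableSlice T Z := by
  rintro ⟨W, -, rfl, hW⟩
  obtain ⟨μ, hμ, hμZ, hent, -⟩ := h
  set H := packingEntropy T (⋃ i, W i) with hH
  have hmeas := measurable_localUpperEntropy hT μ
  have hlt : ∀ᵐ x ∂μ, localUpperEntropy T μ x < H := by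
    refine ae_of_measure_inter_eq_zero hμZ (measurableSet_lt hmeas measurable_const) ?_
    refine measure_mono_null ?_ (measure_iUnion_null fun i =>
      measure_packingEntropy_lt_localUpperEntropy T μ (W i))
    rintro x ⟨hx, hHx⟩
    obtain ⟨i, hi⟩ := mem_iUnion.1 hx
    exact mem_iUnion.2 ⟨i, hi, (hW i).trans_le (not_lt.1 hHx)⟩
  have hint : ∫⁻ x, localUpperEntropy T μ x ∂μ < ∫⁻ _, H ∂μ := by
    refine lintegral_strict_mono (NeZero.ne μ) aemeasurable_const ?_ hlt
    exact (show ∫⁻ x, localUpperEntropy T μ x ∂μ = H from hent) ▸ hfin.ne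
  simp only [lintegral_const, measure_univ, mul_one] at hint
  exact hint.ne hent

end MaxImpliesNoSlice

/-! ### Bowen's estimate for `h`-expansive systems -/

/-- The points of `A` can be coloured with `k` colours so that points of the same colour are at
distance at most `δ` for the `n`-th Bowen metric: `A` is a union of `k` sets of `d_n`-diameter at
most `δ`. -/
def HasBowenColoring {X : Type*} [MetricSpace X] (T : X → X) (n : ℕ) (δ : ℝ) (A : Set X)
    (k : ℕ) : Prop :=
  ∃ φ : X → Fin k, ∀ u ∈ A, ∀ v ∈ A, φ u = φ v → ∀ i < n, dist (T^[i] u) (T^[i] v) ≤ δ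

section Coloring

variable {X : Type*} [MetricSpace X] {T : X → X} {m n k l : ℕ} {δ : ℝ} {A B : Set X}

theorem HasBowenColoring.mono (h : HasBowenColoring T n δ A k) (hBA : B ⊆ A) (hmn : m ≤ n) :
    HasBowenColoring T m δ B k := by
  obtain ⟨φ, hφ⟩ := h
  exact ⟨φ, fun u hu v hv huv i hi => hφ u (hBA hu) v (hBA hv) huv i (hi.trans_le hmn)⟩

theorem HasBowenColoring.add (h : HasBowenColoring T m δ A k)
    (h' : HasBowenColoring T n δ (T^[m] '' A) l) : HasBowenColoring T (m + n) δ A (k * l) := by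
  obtain ⟨φ, hφ⟩ := h
  obtain ⟨ψ, hψ⟩ := h'
  refine ⟨fun u => finProdFinEquiv (φ u, ψ (T^[m] u)), fun u hu v hv huv i hi => ?_⟩
  have heq := Prod.mk.inj (finProdFinEquiv.injective huv)
  rcases lt_or_ge i m with him | him
  · exact hφ u hu v hv heq.1 i him
  · have := hψ _ (mem_image_of_mem _ hu) _ (mem_image_of_mem _ hv) heq.2 (i - m) (by omega)
    rwa [← Function.iterate_add_apply, ← Function.iterate_add_apply, Nat.sub_add_cancel him] at this

theorem HasBowenColoring.of_cover {t : Finset X} (ht : t.Nonempty)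
    (h : A ⊆ ⋃ z ∈ t, bowenBall T n z (δ / 2)) : HasBowenColoring T n δ A t.card := by
  classical
  obtain ⟨z₀, hz₀⟩ := ht
  have hc : ∀ u : X, ∃ z : t, u ∈ A → u ∈ bowenBall T n z (δ / 2) := by
    intro u
    by_cases hu : u ∈ A
    · obtain ⟨z, hz, huz⟩ := mem_iUnion₂.1 (h hu)
      exact ⟨⟨z, hz⟩, fun _ => huz⟩
    · exact ⟨⟨z₀, hz₀⟩, fun hu' => absurd hu' hu⟩
  choose c hc using hc
  refine ⟨fun u => t.equivFin (c u), fun u hu v hv huv i hi => ?_⟩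
  have heq : c u = c v := t.equivFin.injective huv
  have h1 := hc u hu i hi
  have h2 := hc v hv i hi
  rw [← heq] at h2
  have h3 := dist_triangle_left (T^[i] u) (T^[i] v) (T^[i] (c u : X))
  linarith

theorem HasBowenColoring.card_le (h : HasBowenColoring T n δ A k) {F : Finset X}
    (hF : (F : Set X) ⊆ A)
    (hd : (F : Set X).PairwiseDisjoint fun x => closedBowenBall T n x δ) (hδ : 0 ≤ δ) :
    F.card ≤ k := by
  obtain ⟨φ, hφ⟩ := h
  rw [← Fintype.card_fin k, ← Finset.card_univ]
  refine Finset.card_le_card_of_injOn φ (fun _ _ => Finset.mem_coe.2 (Finset.mem_univ _)) ?_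
  intro u hu v hv huv
  by_contra hne
  have hmem : v ∈ closedBowenBall T n u δ := hφ u (hF hu) v (hF hv) huv
  exact disjoint_left.1 (hd hu hv hne) hmem fun i _ => by simpa using hδ

theorem exists_hasBowenColoring_pow [CompactSpace X] (T : X → X) (hδ : 0 < δ) :
    ∃ k : ℕ, ∀ n, HasBowenColoring T n δ univ (k ^ n) := by
  classical
  rcases isEmpty_or_nonempty X with hX | ⟨⟨x₀⟩⟩
  · exact ⟨0, fun n => ⟨isEmptyElim, fun u => isEmptyElim u⟩⟩
  obtain ⟨t, -, htf, ht⟩ := isCompact_univ.finite_cover_balls (X := X) (half_pos hδ)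
  have h1 : HasBowenColoring T 1 δ univ (insert x₀ htf.toFinset).card := by
    refine .of_cover (Finset.insert_nonempty _ _) fun u hu => ?_
    obtain ⟨z, hz, huz⟩ := mem_iUnion₂.1 (ht hu)
    refine mem_iUnion₂.2 ⟨z, by simp [hz], fun i hi => ?_⟩
    obtain rfl : i = 0 := by omega
    simpa [dist_comm] using huz
  refine ⟨(insert x₀ htf.toFinset).card, fun n => ?_⟩
  induction n with
  | zero => exact ⟨fun _ => ⟨0, by simp⟩, fun u _ v _ _ i hi => absurd hi (by omega)⟩
  | succ n ih => rw [pow_succ]; exact ih.add (h1.mono (subset_univ _) le_rfl)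

theorem isOpen_bowenBall (hT : Continuous T) (n : ℕ) (x : X) (ε : ℝ) :
    IsOpen (bowenBall T n x ε) := by
  have : bowenBall T n x ε = ⋂ k ∈ Finset.range n, {y | dist (T^[k] x) (T^[k] y) < ε} := by
    ext y; simp [bowenBall]
  rw [this]
  exact isOpen_biInter_finset fun k _ => isOpen_lt (continuous_const.dist (hT.iterate k))
    continuous_const

/-- A set of vanishing topological entropy is covered by at most `exp (β m)` Bowen balls of some
positive order `m`. -/
theorem exists_cover_of_coverEntropy_le_zero {Y : Set X}
    (hY : Y.Nonempty) (h : Dynamics.coverEntropy T Y ≤ 0) {β : ℝ} (hβ : 0 < β) (hδ : 0 < δ) :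
    ∃ (m : ℕ) (t : Finset X), 0 < m ∧ t.Nonempty ∧ (t.card : ℝ) ≤ Real.exp (β * m) ∧
      Y ⊆ ⋃ z ∈ t, bowenBall T m z δ := by
  set U : SetRel X X := {p | dist p.1 p.2 < δ} with hU
  have hUmem : U ∈ uniformity X := Metric.dist_mem_uniformity hδ
  have hlt : ExpGrowth.expGrowthSup (fun n => ((Dynamics.coverMincard T Y U n : ℕ∞) : ℝ≥0∞)) <
      (β : EReal) :=
    ((Dynamics.coverEntropyEntourage_le_coverEntropy T Y hUmem).trans h).trans_lt
      (by exact_mod_cast hβ)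
  obtain ⟨m, hm, hm0⟩ := ((ExpGrowth.eventually_le_exp hlt).and (eventually_gt_atTop 0)).exists
  have hexp : EReal.exp ((β : EReal) * (m : EReal)) = ENNReal.ofReal (Real.exp (β * m)) := by
    rw [← EReal.exp_coe]; norm_cast
  rw [hexp] at hm
  have hfin : Dynamics.coverMincard T Y U m < ⊤ := by
    refine lt_top_iff_ne_top.2 fun htop => ?_
    rw [htop] at hm
    simp at hm
  obtain ⟨t, ht, htc⟩ := (Dynamics.coverMincard_finite_iff T Y U m).1 hfin
  rw [← htc] at hm
  refine ⟨m, t, hm0, ?_, ?_, fun y hy => ?_⟩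
  · exact_mod_cast ht.nonempty hY
  · have h2 := ENNReal.toReal_mono ENNReal.ofReal_ne_top hm
    rw [ENNReal.toReal_ofReal (Real.exp_pos _).le] at h2
    simpa using h2
  · obtain ⟨z, hz, hyz⟩ := ht hy
    refine mem_iUnion₂.2 ⟨z, hz, fun i hi => ?_⟩
    rw [dist_comm]
    exact Dynamics.mem_dynEntourage.1 hyz i hi

/-- A neighbourhood of the shadow set `Φ_ε(y)` contains the closed Bowen balls of radius `ε` and
large order around all points near `y`. -/
theorem exists_closedBowenBall_subset_of_shadowSet_subset [CompactSpace X] (hT : Continuous T)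
    {ε : ℝ} {y : X} {U : Set X} (hU : IsOpen U) (h : shadowSet T ε y ⊆ U) :
    ∃ N : ℕ, ∃ V ∈ nhds y, ∀ x ∈ V, closedBowenBall T N x ε ⊆ U := by
  set C : ℕ → Set (X × X) := fun N => {p | dist p.1 y ≤ 1 / ((N : ℝ) + 1)} ∩
    ({p | ∀ i < N, dist (T^[i] p.1) (T^[i] p.2) ≤ ε} ∩ {p | p.2 ∉ U}) with hC
  have hclosed : ∀ N, IsClosed (C N) := by
    intro N
    refine (isClosed_le (continuous_fst.dist continuous_const) continuous_const).inter
      (IsClosed.inter ?_ (hU.isClosed_compl.preimage continuous_snd))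
    simp only [ofPred_forall]
    exact isClosed_iInter fun i => isClosed_iInter fun _ => isClosed_le
      (((hT.iterate i).comp continuous_fst).dist ((hT.iterate i).comp continuous_snd))
      continuous_const
  have hanti : ∀ N, C (N + 1) ⊆ C N := by
    intro N p hp
    have h1 : dist p.1 y ≤ 1 / (((N + 1 : ℕ) : ℝ) + 1) := hp.1
    exact ⟨h1.trans (Nat.one_div_le_one_div N.le_succ), fun i hi => hp.2.1 i (by omega), hp.2.2⟩
  obtain ⟨N, hN⟩ : ∃ N, C N = ∅ := by
    by_contra! hne
    obtain ⟨p, hp⟩ := IsCompact.nonempty_iInter_of_sequence_nonempty_isCompact_isClosed C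
      hanti hne (hclosed 0).isCompact hclosed
    rw [mem_iInter] at hp
    have hpy : p.1 = y := by
      refine dist_le_zero.1 (ge_of_tendsto' tendsto_one_div_add_atTop_nhds_zero_nat fun N => ?_)
      exact (hp N).1
    refine (hp 0).2.2 (h (mem_iInter.2 fun i => ?_))
    rw [mem_preimage, Metric.mem_closedBall, dist_comm, ← hpy]
    exact (hp (i + 1)).2.1 i (by omega)
  refine ⟨N, Metric.closedBall y (1 / ((N : ℝ) + 1)),
    Metric.closedBall_mem_nhds y Nat.one_div_pos_of_nat, fun x hx u hu => ?_⟩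
  by_contra huU
  exact (hN ▸ (⟨hx, hu, huU⟩ : (x, u) ∈ C N) : (x, u) ∈ (∅ : Set (X × X)))

/-- If all shadow sets at scale `ε` have zero entropy, then closed Bowen balls of radius `ε` and
order `n` split into `O(exp (β n))` pieces of small `d_n`-diameter, uniformly in the centre. An
orbit segment of length `n` is cut into blocks whose lengths take finitely many values, each
following the shadow set of one of finitely many points. -/
theorem exists_hasBowenColoring_closedBowenBall [CompactSpace X] (hT : Continuous T) {ε : ℝ}
    (hε : 0 < ε) (h : hStar T ε = 0) {β : ℝ} (hβ : 0 < β) (hδ : 0 < δ) :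
    ∃ C : ℝ, 0 ≤ C ∧ ∀ (n : ℕ) (x : X), ∃ k : ℕ, (k : ℝ) ≤ C * Real.exp (β * n) ∧
      HasBowenColoring T n δ (closedBowenBall T n x ε) k := by
  have hent : ∀ y, Dynamics.coverEntropy T (shadowSet T ε y) ≤ 0 := by
    intro y
    have := (iSup_eq_bot.1 h) y
    exact EReal.toENNReal_eq_zero_iff.1 this
  have hne : ∀ y, (shadowSet T ε y).Nonempty := fun y =>
    ⟨y, mem_iInter.2 fun i => Metric.mem_closedBall_self hε.le⟩
  choose m t hm ht htc hcov using fun y =>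
    exists_cover_of_coverEntropy_le_zero (hne y) (hent y) hβ (half_pos hδ)
  choose N V hV hNV using fun y =>
    exists_closedBowenBall_subset_of_shadowSet_subset hT
      (isOpen_biUnion fun z _ => isOpen_bowenBall hT (m y) z (δ / 2)) (hcov y)
  obtain ⟨S, hS⟩ := CompactSpace.elim_nhds_subcover V hV
  set R := S.sup fun y => max (N y) (m y) with hR
  obtain ⟨k₀, hk₀⟩ := exists_hasBowenColoring_pow (X := X) T hδ
  refine ⟨(k₀ ^ R : ℕ), Nat.cast_nonneg _, fun n => ?_⟩
  induction n using Nat.strong_induction_on with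
  | _ n ih =>
    intro x
    -- short segments are coloured outright; from a long one, the first block of length `m y` is cut
    rcases le_or_gt n R with hn | hn
    · refine ⟨k₀ ^ R, ?_, (hk₀ R).mono (subset_univ _) hn⟩
      exact le_mul_of_one_le_right (by positivity) (Real.one_le_exp (by positivity))
    obtain ⟨y, hyS, hxy⟩ := mem_iUnion₂.1 (hS ▸ mem_univ x : x ∈ ⋃ y ∈ S, V y)
    have hyR : max (N y) (m y) ≤ R := Finset.le_sup (f := fun y => max (N y) (m y)) hyS
    have hNn : N y ≤ n := (le_max_left _ _).trans (hyR.trans hn.le)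
    have hmn : m y ≤ n := (le_max_right _ _).trans (hyR.trans hn.le)
    obtain ⟨k, hk, hcol⟩ := ih (n - m y) (by have := hm y; omega) (T^[m y] x)
    refine ⟨(t y).card * k, ?_, ?_⟩
    · push_cast
      have hsplit : Real.exp (β * n) = Real.exp (β * m y) * Real.exp (β * (n - m y : ℕ)) := by
        rw [← Real.exp_add, Nat.cast_sub hmn]; ring_nf
      rw [hsplit]
      calc ((t y).card : ℝ) * k
          ≤ Real.exp (β * m y) * ((k₀ ^ R : ℕ) * Real.exp (β * (n - m y : ℕ))) := by
            gcongr
            exact htc y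
        _ = _ := by push_cast; ring
    · have hfirst : HasBowenColoring T (m y) δ (closedBowenBall T n x ε) (t y).card :=
        .of_cover (ht y) fun u hu => hNV y x hxy fun i hi => hu i (hi.trans_le hNn)
      have := hfirst.add (hcol.mono (B := T^[m y] '' closedBowenBall T n x ε) ?_ le_rfl)
      · rwa [Nat.add_sub_cancel' hmn] at this
      · rintro _ ⟨u, hu, rfl⟩ i hi
        rw [← Function.iterate_add_apply, ← Function.iterate_add_apply]
        exact hu (i + m y) (by omega)

/-- In an `h`-expansive system, passing from scale `ε / 2` to any scale `δ` costs an arbitrarily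
small rate: a maximal packing at scale `ε / 2` covers `W` by Bowen balls of radius `ε`, and each of
these meets a packing at scale `δ` in `O(exp (β n))` centres. -/
theorem PackingGrowth.of_hStar_eq_zero [CompactSpace X] (hT : Continuous T) {ε : ℝ}
    (hε : 0 < ε) (h : hStar T ε = 0) {β : ℝ≥0} (hβ : 0 < β) (hδ : 0 < δ) {W : Set X} {s : ℝ≥0}
    (hW : PackingGrowth T W s (ε / 2)) : PackingGrowth T W (s + β) δ := by
  classical
  obtain ⟨C, hC0, hC⟩ := exists_hasBowenColoring_closedBowenBall hT hε h
    (β := (β : ℝ)) (by exact_mod_cast hβ) hδ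
  obtain ⟨K, N, hK⟩ := hW
  refine ⟨K * C, N, fun n hn F hF hFd => ?_⟩
  obtain ⟨E, hEW, hEd, hEcov⟩ := exists_finset_cover_closedBowenBall (T := T) (n := n) (W := W)
    (half_pos hε).le (B := ⌊K * Real.exp (s * n)⌋₊)
    fun F hF hFd => Nat.le_floor (hK n hn F hF hFd)
  rw [mul_div_cancel₀ _ (two_ne_zero' ℝ)] at hEcov
  choose k hk hcol using hC n
  have hsub : F ⊆ E.biUnion fun e => F.filter fun u => u ∈ closedBowenBall T n e ε := by
    intro u hu
    obtain ⟨e, he, hue⟩ := mem_iUnion₂.1 (hEcov (hF hu))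
    exact Finset.mem_biUnion.2 ⟨e, he, Finset.mem_filter.2 ⟨hu, hue⟩⟩
  have hpiece : ∀ e, (F.filter fun u => u ∈ closedBowenBall T n e ε).card ≤ k e := fun e =>
    (hcol e).card_le (fun u hu => (Finset.mem_filter.1 hu).2)
      (hFd.subset fun u hu => (Finset.mem_filter.1 hu).1) hδ.le
  have hE := hK n hn E hEW hEd
  calc (F.card : ℝ)
      ≤ ∑ e ∈ E, ((F.filter fun u => u ∈ closedBowenBall T n e ε).card : ℝ) := by
        exact_mod_cast (Finset.card_le_card hsub).trans Finset.card_biUnion_le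
    _ ≤ ∑ e ∈ E, C * Real.exp (β * n) :=
        Finset.sum_le_sum fun e _ => le_trans (by exact_mod_cast hpiece e) (hk e)
    _ = E.card * (C * Real.exp (β * n)) := by rw [Finset.sum_const, nsmul_eq_mul]
    _ ≤ K * Real.exp (s * n) * (C * Real.exp (β * n)) := by
        gcongr
    _ = K * C * Real.exp (((s + β : ℝ≥0) : ℝ) * n) := by
        rw [NNReal.coe_add, add_mul, Real.exp_add]; ring

/-- At a scale of `h`-expansiveness the packing entropy of every set is already attained. -/
theorem packingEntropy_eq_packingEntropyAt [CompactSpace X] (hT : Continuous T) {ε : ℝ}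
    (hε : 0 < ε) (h : hStar T ε = 0) (Z : Set X) :
    packingEntropy T Z = packingEntropyAt T Z (ε / 2) := by
  refine le_antisymm (iSup₂_le fun δ hδ => ?_) (packingEntropyAt_le_packingEntropy (half_pos hε))
  refine le_of_forall_gt_imp_ge_of_dense fun b hb => ?_
  obtain ⟨s, hs, hsb⟩ := ENNReal.lt_iff_exists_nnreal_btwn.1 hb
  obtain ⟨W, hW, hg⟩ := exists_cover_packingGrowth hs
  refine le_trans (ENNReal.le_of_forall_pos_le_add fun β hβ _ => ?_) hsb.le
  rw [← ENNReal.coe_add]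
  exact packingEntropyAt_le_of_cover hW fun i => (hg i).of_hStar_eq_zero hT hε h hβ hδ

theorem packingEntropyAt_lt_top [CompactSpace X] (T : X → X) (hδ : 0 < δ) (Z : Set X) :
    packingEntropyAt T Z δ < ⊤ := by
  obtain ⟨k, hk⟩ := exists_hasBowenColoring_pow (X := X) T hδ
  refine (packingEntropyAt_le_of_cover (s := (Real.log k).toNNReal) (W := fun _ => univ)
    (fun x _ => by simp) fun _ => ⟨1, 0, fun n _ F _ hd => ?_⟩).trans_lt ENNReal.coe_lt_top
  calc (F.card : ℝ) ≤ (k : ℝ) ^ n := by exact_mod_cast (hk n).card_le (subset_univ _) hd hδ.le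
    _ ≤ Real.exp (Real.log k) ^ n := by gcongr; exact Real.le_exp_log _
    _ = Real.exp (n * Real.log k) := (Real.exp_nat_mul _ _).symm
    _ ≤ 1 * Real.exp ((Real.log k).toNNReal * n) := by
        rw [one_mul, mul_comm]
        gcongr
        exact Real.le_coe_toNNReal _

end Coloring

/-! ### A measure carried by a branching tree -/

/-- The path of the real number `t ∈ [0, 1)` in the tree of finite sequences of integers in which
the vertex `τ` has the children `d :: τ`, `d < M τ`: at each vertex, the child is selected by
cutting `[0, 1)` into `M τ` equal intervals. The choices at different levels are all made with the
same `t` and need not be independent: what matters is only that each child of `τ` is selected with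
probability at most `1 / M τ`. -/
noncomputable def branchPath (M : List ℕ → ℕ) (t : ℝ) : ℕ → List ℕ
  | 0 => []
  | p + 1 => ⌊M (branchPath M t p) * t⌋₊ :: branchPath M t p

theorem length_branchPath (M : List ℕ → ℕ) (t : ℝ) (p : ℕ) : (branchPath M t p).length = p := by
  induction p with
  | zero => rfl
  | succ p ih => simp [branchPath, ih]

theorem measurableSet_branchPath_eq (M : List ℕ → ℕ) (p : ℕ) (l : List ℕ) :
    MeasurableSet {t | branchPath M t p = l} := by
  induction p generalizing l with
  | zero => simp only [branchPath]; exact MeasurableSet.const _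
  | succ p ih =>
    rcases l with _ | ⟨d, τ⟩
    · simp [branchPath]
    · have : {t | branchPath M t (p + 1) = d :: τ} =
          {t | branchPath M t p = τ} ∩ (fun t : ℝ => ⌊M τ * t⌋₊) ⁻¹' {d} := by
        ext t
        simp only [branchPath, List.cons.injEq, mem_ofPred_eq, mem_inter_iff, mem_preimage,
          mem_singleton_iff]
        constructor
        · rintro ⟨h1, h2⟩
          exact ⟨h2, h2 ▸ h1⟩
        · rintro ⟨h1, h2⟩
          exact ⟨h1 ▸ h2, h1⟩
      rw [this]
      exact (ih τ).inter ((Nat.measurable_floor.comp (measurable_const.mul measurable_id))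
        (measurableSet_singleton d))

theorem measurable_comp_branchPath {α : Type*} [MeasurableSpace α] (M : List ℕ → ℕ) (p : ℕ)
    (g : List ℕ → α) : Measurable fun t => g (branchPath M t p) := by
  let : MeasurableSpace (List ℕ) := ⊤
  exact (measurable_from_top (f := g)).comp
    (measurable_to_countable' fun l => measurableSet_branchPath_eq M p l)

theorem floor_lt_of_mem_Ico {m : ℕ} (hm : 0 < m) {t : ℝ} (ht : t ∈ Ico (0 : ℝ) 1) :
    ⌊(m : ℝ) * t⌋₊ < m := by
  have hm' : (0 : ℝ) < m := by exact_mod_cast hm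
  rw [Nat.floor_lt (mul_nonneg hm'.le ht.1)]
  nlinarith [ht.2]

theorem volume_branchPath_succ_eq_le {M : List ℕ → ℕ} (hM : ∀ τ, 0 < M τ) (t : ℝ) (p : ℕ) :
    volume {u | u ∈ Ico (0 : ℝ) 1 ∧ branchPath M u (p + 1) = branchPath M t (p + 1)} ≤
      ENNReal.ofReal (1 / M (branchPath M t p)) := by
  set m := M (branchPath M t p) with hm
  set d := ⌊(m : ℝ) * t⌋₊ with hd
  have hm' : (0 : ℝ) < m := by exact_mod_cast hM _
  have hsub : {u | u ∈ Ico (0 : ℝ) 1 ∧ branchPath M u (p + 1) = branchPath M t (p + 1)} ⊆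
      Ico (d / m : ℝ) ((d + 1) / m) := by
    rintro u ⟨hu, hut⟩
    obtain ⟨h1, h2⟩ := List.cons.inj hut
    rw [h2] at h1
    rw [← hm] at h1
    have h3 := Nat.floor_le (mul_nonneg hm'.le hu.1)
    have h4 := Nat.lt_floor_add_one ((m : ℝ) * u)
    rw [h1] at h3 h4
    rw [mem_Ico, div_le_iff₀' hm', lt_div_iff₀' hm']
    exact ⟨h3, h4⟩
  refine (measure_mono hsub).trans ?_
  rw [Real.volume_Ico]
  refine ENNReal.ofReal_le_ofReal (le_of_eq ?_)
  ring

section Tree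

variable {X Y : Type*} [MetricSpace X] [MetricSpace Y] {T : X → X} {f : Y → X} {ε : ℝ}
  {s : ℕ → ℝ≥0}

/-- One branching step: near `a` there are at least `exp (s p * n)` disjoint small balls whose
images under `f` are separated by time `n`. -/
theorem exists_separated_closedBalls (hT : Continuous T) (hf : Continuous f) (hε : 0 < ε)
    (H : ∀ V : Set Y, IsOpen V → V.Nonempty → ∀ p N : ℕ, ∃ n ≥ N, ∃ F : Finset Y, (F : Set Y) ⊆ V ∧
      Real.exp (s p * n) ≤ F.card ∧ ∀ a ∈ F, ∀ b ∈ F, a ≠ b →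
        ∃ k < n, ε < dist (T^[k] (f a)) (T^[k] (f b)))
    (a : Y) (r : {r : ℝ // 0 < r}) (N p : ℕ) :
    ∃ (n M : ℕ) (c : ℕ → Y) (ρ : {r : ℝ // 0 < r}), N ≤ n ∧ Real.exp (s p * n) ≤ M ∧
      (ρ : ℝ) ≤ r / 2 ∧ (∀ i < M, Metric.closedBall (c i) ρ ⊆ Metric.closedBall a r) ∧
      ∀ i < M, ∀ j < M, i ≠ j → ∀ u ∈ Metric.closedBall (c i) (ρ : ℝ),
        ∀ v ∈ Metric.closedBall (c j) (ρ : ℝ),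
          ∃ k < n, ε / 2 ≤ dist (T^[k] (f u)) (T^[k] (f v)) := by
  obtain ⟨n, hn, F, hFV, hFc, hFs⟩ := H (Metric.ball a r) Metric.isOpen_ball
    ⟨a, Metric.mem_ball_self r.2⟩ p N
  have hev : ∀ᶠ ρ : ℝ in nhdsWithin 0 (Ioi 0), ∀ b ∈ F,
      Metric.closedBall b ρ ⊆ f ⁻¹' bowenBall T n (f b) (ε / 4) ∩ Metric.ball a r := by
    refine (Finset.eventually_all F).2 fun b hb => ?_
    have hnhds : f ⁻¹' bowenBall T n (f b) (ε / 4) ∩ Metric.ball a r ∈ nhds b := by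
      refine (((isOpen_bowenBall hT n (f b) (ε / 4)).preimage hf).inter
        Metric.isOpen_ball).mem_nhds ⟨fun k _ => ?_, hFV hb⟩
      rw [dist_self]; positivity
    obtain ⟨ρ₀, hρ₀, hsub⟩ := Metric.nhds_basis_closedBall.mem_iff.1 hnhds
    filter_upwards [Ioc_mem_nhdsGT hρ₀] with ρ hρ
    exact (Metric.closedBall_subset_closedBall hρ.2).trans hsub
  obtain ⟨ρ, hρF, hρ⟩ := (hev.and (Ioc_mem_nhdsGT (half_pos r.2))).exists
  let c : ℕ → Y := fun i => if h : i < F.card then F.equivFin.symm ⟨i, h⟩ else a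
  have hcF : ∀ i < F.card, c i ∈ F := by
    intro i hi
    simp only [c, hi, dif_pos]
    exact Subtype.coe_prop _
  have hcinj : ∀ i < F.card, ∀ j < F.card, i ≠ j → c i ≠ c j := by
    intro i hi j hj hij heq
    simp only [c, hi, hj, dif_pos] at heq
    exact hij (Fin.mk.inj (F.equivFin.symm.injective (Subtype.ext heq)))
  refine ⟨n, F.card, c, ⟨ρ, hρ.1⟩, hn, hFc, hρ.2, fun i hi => ?_, ?_⟩
  · exact ((hρF _ (hcF i hi)).trans inter_subset_right).trans Metric.ball_subset_closedBall
  · intro i hi j hj hij u hu v hv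
    obtain ⟨k, hk, hd⟩ := hFs _ (hcF i hi) _ (hcF j hj) (hcinj i hi j hj hij)
    refine ⟨k, hk, ?_⟩
    have h1 := (hρF _ (hcF i hi) hu).1 k hk
    have h2 := (hρF _ (hcF j hj) hv).1 k hk
    have h3 := dist_triangle4 (T^[k] (f (c i))) (T^[k] (f u)) (T^[k] (f v)) (T^[k] (f (c j)))
    rw [dist_comm (T^[k] (f v))] at h3
    linarith

/-- Iterating the branching step gives a tree of closed balls. The vertex `τ` has `M τ` children,
whose balls are separated by time `ν τ`. -/
theorem exists_separated_tree [Nonempty Y] (hT : Continuous T) (hf : Continuous f) (hε : 0 < ε)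
    (H : ∀ V : Set Y, IsOpen V → V.Nonempty → ∀ p N : ℕ, ∃ n ≥ N, ∃ F : Finset Y, (F : Set Y) ⊆ V ∧
      Real.exp (s p * n) ≤ F.card ∧ ∀ a ∈ F, ∀ b ∈ F, a ≠ b →
        ∃ k < n, ε < dist (T^[k] (f a)) (T^[k] (f b))) :
    ∃ (ν M : List ℕ → ℕ) (a : List ℕ → Y) (r : List ℕ → ℝ), r [] = 1 ∧ (∀ τ, 0 < r τ) ∧
      (∀ d τ, r (d :: τ) ≤ r τ / 2) ∧ (∀ d τ, ν τ < ν (d :: τ)) ∧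
      (∀ τ, Real.exp (s τ.length * ν τ) ≤ M τ) ∧
      (∀ τ, ∀ i < M τ,
        Metric.closedBall (a (i :: τ)) (r (i :: τ)) ⊆ Metric.closedBall (a τ) (r τ)) ∧
      ∀ τ, ∀ i < M τ, ∀ j < M τ, i ≠ j → ∀ u ∈ Metric.closedBall (a (i :: τ)) (r (i :: τ)),
        ∀ v ∈ Metric.closedBall (a (j :: τ)) (r (j :: τ)),
          ∃ k < ν τ, ε / 2 ≤ dist (T^[k] (f u)) (T^[k] (f v)) := by
  choose n M c ρ hn hM hρ hsub hsep using exists_separated_closedBalls (s := s) hT hf hε H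
  -- a vertex carries a centre, a radius and a lower bound for the separation time of its children
  let node : List ℕ → Y × {r : ℝ // 0 < r} × ℕ := fun l =>
    List.rec (Classical.arbitrary Y, ⟨1, one_pos⟩, 0)
      (fun d τ x => (c x.1 x.2.1 x.2.2 τ.length d, ρ x.1 x.2.1 x.2.2 τ.length,
        n x.1 x.2.1 x.2.2 τ.length + 1)) l
  refine ⟨fun τ => n (node τ).1 (node τ).2.1 (node τ).2.2 τ.length,
    fun τ => M (node τ).1 (node τ).2.1 (node τ).2.2 τ.length,
    fun τ => (node τ).1, fun τ => (node τ).2.1, rfl, fun τ => (node τ).2.1.2,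
    fun d τ => hρ _ _ _ _, fun d τ => ?_, fun τ => hM _ _ _ _, fun τ i hi => hsub _ _ _ _ i hi,
    fun τ i hi j hj hij => hsep _ _ _ _ i hi j hj hij⟩
  exact Nat.lt_of_succ_le (hn (node (d :: τ)).1 (node (d :: τ)).2.1 (node (d :: τ)).2.2 _)

/-- If every nonempty open subset of a complete space `Y` contains, for arbitrarily large `n`, at
least `exp (s p * n)` points whose images under `f` are separated by time `n`, then `f` maps some
random point of `Y` to a point with local upper entropy at least `sup s`, at a fixed scale. -/
theorem exists_measure_le_localUpperEntropy [SecondCountableTopology X] [MeasurableSpace X]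
    [BorelSpace X] [CompleteSpace Y] [Nonempty Y] (hT : Continuous T) (hf : Continuous f)
    (hε : 0 < ε) (hs : Monotone s)
    (H : ∀ V : Set Y, IsOpen V → V.Nonempty → ∀ p N : ℕ, ∃ n ≥ N, ∃ F : Finset Y, (F : Set Y) ⊆ V ∧
      Real.exp (s p * n) ≤ F.card ∧ ∀ a ∈ F, ∀ b ∈ F, a ≠ b →
        ∃ k < n, ε < dist (T^[k] (f a)) (T^[k] (f b))) :
    ∃ μ : Measure X, IsProbabilityMeasure μ ∧ μ (range f) = 1 ∧
      ∀ᵐ x ∂μ, ∀ q, (s q : ℝ≥0∞) ≤ localUpperEntropy T μ x := by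
  obtain ⟨ν, M, a, r, hr1, hr0, hrd, hν, hM, hsub, hsep⟩ := exists_separated_tree hT hf hε H
  have hMpos : ∀ τ, 0 < M τ := fun τ => by
    exact_mod_cast (Real.exp_pos _).trans_le (hM τ)
  set σ : ℝ → ℕ → List ℕ := branchPath M with hσ
  have hdigit : ∀ t ∈ Ico (0 : ℝ) 1, ∀ p, ⌊M (σ t p) * t⌋₊ < M (σ t p) :=
    fun t ht p => floor_lt_of_mem_Ico (hMpos _) ht
  have hrle : ∀ t p, r (σ t p) ≤ (1 / 2) ^ p := by
    intro t p
    induction p with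
    | zero => exact hr1.le
    | succ p ih =>
      calc r (σ t (p + 1)) ≤ r (σ t p) / 2 := hrd _ _
        _ ≤ (1 / 2) ^ p / 2 := by gcongr
        _ = _ := by ring
  have hanti : ∀ t ∈ Ico (0 : ℝ) 1,
      Antitone fun p => Metric.closedBall (a (σ t p)) (r (σ t p)) := fun t ht =>
    antitone_nat_of_succ_le fun p => hsub _ _ (hdigit t ht p)
  have hνmono : ∀ t, StrictMono fun p => ν (σ t p) := fun t =>
    strictMono_nat_of_lt_succ fun p => hν _ _
  have hlim : ∀ t, ∃ y, t ∈ Ico (0 : ℝ) 1 →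
      Tendsto (fun p => a (σ t p)) atTop (nhds y) ∧
        ∀ p, y ∈ Metric.closedBall (a (σ t p)) (r (σ t p)) := by
    intro t
    by_cases ht : t ∈ Ico (0 : ℝ) 1
    swap
    · exact ⟨Classical.arbitrary Y, fun h => absurd h ht⟩
    have hmem : ∀ p q, p ≤ q → a (σ t q) ∈ Metric.closedBall (a (σ t p)) (r (σ t p)) :=
      fun p q hpq => hanti t ht hpq (Metric.mem_closedBall_self (hr0 _).le)
    have hcau : CauchySeq fun p => a (σ t p) := by
      refine cauchySeq_of_le_tendsto_0' (fun p => (1 / 2 : ℝ) ^ p) (fun p q hpq => ?_)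
        (tendsto_pow_atTop_nhds_zero_of_lt_one (by norm_num) (by norm_num))
      rw [dist_comm]
      exact (Metric.mem_closedBall.1 (hmem p q hpq)).trans (hrle t p)
    obtain ⟨y, hy⟩ := cauchySeq_tendsto_of_complete hcau
    refine ⟨y, fun _ => ⟨hy, fun p => ?_⟩⟩
    exact Metric.isClosed_closedBall.mem_of_tendsto hy
      ((eventually_ge_atTop p).mono fun q hq => hmem p q hq)
  choose G hG using hlim
  -- paths that have separated by level `p + 1` are separated dynamically by time `ν (σ t p)`
  have hkey : ∀ t ∈ Ico (0 : ℝ) 1, ∀ u ∈ Ico (0 : ℝ) 1, ∀ p, σ u (p + 1) ≠ σ t (p + 1) →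
      ∃ k < ν (σ t p), ε / 2 ≤ dist (T^[k] (f (G t))) (T^[k] (f (G u))) := by
    intro t ht u hu p
    induction p with
    | zero =>
      intro hne
      refine hsep (σ t 0) _ (hdigit t ht 0) _ (hdigit u hu 0) (fun heq => hne ?_) _
        ((hG t ht).2 1) _ ((hG u hu).2 1)
      exact congrArg (fun d => [d]) heq.symm
    | succ p ih =>
      intro hne
      by_cases heq : σ u (p + 1) = σ t (p + 1)
      · have hu' := hdigit u hu (p + 1)
        have hGu := (hG u hu).2 (p + 2)
        have hstep : σ u (p + 2) = ⌊M (σ u (p + 1)) * u⌋₊ :: σ u (p + 1) := rfl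
        rw [hstep] at hGu hne
        rw [heq] at hu' hGu hne
        exact hsep (σ t (p + 1)) _ (hdigit t ht (p + 1)) _ hu'
          (fun h => hne (congrArg (fun d => d :: σ t (p + 1)) h.symm)) _ ((hG t ht).2 (p + 2)) _ hGu
      · obtain ⟨k, hk, hd⟩ := ih heq
        exact ⟨k, hk.trans (hνmono t p.lt_succ_self), hd⟩
  let L : Measure ℝ := volume.restrict (Ico 0 1)
  have hL : IsProbabilityMeasure L := ⟨by simp [L]⟩
  have hIco : ∀ᵐ t ∂L, t ∈ Ico (0 : ℝ) 1 := ae_restrict_mem measurableSet_Ico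
  have hmeas : AEMeasurable (fun t => f (G t)) L := by
    refine aemeasurable_of_tendsto_metrizable_ae' (f := fun p t => f (a (σ t p)))
      (fun p => (measurable_comp_branchPath M p fun l => f (a l)).aemeasurable) ?_
    filter_upwards [hIco] with t ht
    exact (hf.tendsto _).comp (hG t ht).1
  let μ : Measure X := L.map fun t => f (G t)
  have hμ : IsProbabilityMeasure μ := Measure.isProbabilityMeasure_map hmeas
  refine ⟨μ, hμ, ?_, ?_⟩
  · rw [← measure_toMeasurable, Measure.map_apply_of_aemeasurable hmeas
      (measurableSet_toMeasurable _ _)]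
    have : (fun t => f (G t)) ⁻¹' toMeasurable μ (range f) = univ :=
      eq_univ_of_forall fun t => subset_toMeasurable μ _ (mem_range_self _)
    rw [this, measure_univ]
  have hball : ∀ t ∈ Ico (0 : ℝ) 1, ∀ p, μ (bowenBall T (ν (σ t p)) (f (G t)) (ε / 2)) ≤
      ENNReal.ofReal (Real.exp (-(s p : ℝ) * ν (σ t p))) := by
    intro t ht p
    rw [Measure.map_apply_of_aemeasurable hmeas (isOpen_bowenBall hT _ _ _).measurableSet,
      Measure.restrict_apply' measurableSet_Ico]
    refine (measure_mono ?_).trans ((volume_branchPath_succ_eq_le hMpos t p).trans ?_)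
    · rintro u ⟨hu, huI⟩
      refine ⟨huI, ?_⟩
      by_contra hne
      obtain ⟨k, hk, hd⟩ := hkey t ht u huI p hne
      exact absurd (hu k hk) (not_lt.2 hd)
    · refine ENNReal.ofReal_le_ofReal ?_
      have h1 := hM (σ t p)
      rw [hσ, length_branchPath] at h1
      rw [neg_mul, Real.exp_neg, ← one_div]
      exact one_div_le_one_div_of_le (Real.exp_pos _) h1
  have hpoint : ∀ t ∈ Ico (0 : ℝ) 1, ∀ q, (s q : ℝ≥0∞) ≤ localUpperEntropy T μ (f (G t)) := by
    intro t ht q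
    refine le_trans ?_ (le_iSup₂_of_le (f := fun (δ : ℝ) (_ : 0 < δ) =>
      localUpperEntropyAt T μ (f (G t)) δ) (ε / 2) (half_pos hε) le_rfl)
    refine le_limsup_of_frequently_le ?_ (by isBoundedDefault)
    rw [frequently_atTop]
    intro N
    set p := max q (N + 1) with hp
    have hpν : p ≤ ν (σ t p) := (hνmono t).le_apply
    refine ⟨ν (σ t p), by omega, ?_⟩
    have hν0 : (ν (σ t p) : ℝ≥0∞) ≠ 0 := by
      have : ν (σ t p) ≠ 0 := by omega
      exact_mod_cast this
    rw [ENNReal.le_div_iff_mul_le (Or.inl hν0) (Or.inl (ENNReal.natCast_ne_top _))]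
    have hsq : (s q : ℝ≥0∞) * ν (σ t p) ≤ ((s p * ν (σ t p) : ℝ≥0) : ℝ≥0∞) := by
      push_cast
      gcongr
      exact hs (le_max_left _ _)
    refine hsq.trans ?_
    have hb := hball t ht p
    rw [neg_mul, ← ENNReal.log_le_log_iff, log_ofReal_exp] at hb
    rw [← EReal.coe_ennreal_le_coe_ennreal_iff, EReal.coe_toENNReal_eq_max]
    refine le_max_of_le_right ?_
    rw [EReal.le_neg]
    exact hb
  have hset : MeasurableSet {x | ∀ q, (s q : ℝ≥0∞) ≤ localUpperEntropy T μ x} := by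
    simp only [ofPred_forall]
    exact MeasurableSet.iInter fun q =>
      measurableSet_le measurable_const (measurable_localUpperEntropy hT μ)
  rw [ae_map_iff hmeas hset]
  filter_upwards [hIco] with t ht using hpoint t ht

end Tree

/-! ### Sets without increasing countable slices -/

/-- The `σ`-ideal generated by the analytic subsets of `Z` of packing entropy smaller than that of
`Z`. -/
def IsSliceSmall {X : Type*} [MetricSpace X] (T : X → X) (Z A : Set X) : Prop :=
  ∃ W : ℕ → Set X, (∀ i, AnalyticSet (W i)) ∧ (∀ i, W i ⊆ Z) ∧
    (∀ i, packingEntropy T (W i) < packingEntropy T Z) ∧ A ⊆ ⋃ i, W i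

section Slice

variable {X : Type*} [MetricSpace X] {T : X → X} {Z A B : Set X}

theorem IsSliceSmall.mono (h : IsSliceSmall T Z B) (hAB : A ⊆ B) : IsSliceSmall T Z A := by
  obtain ⟨W, h1, h2, h3, h4⟩ := h
  exact ⟨W, h1, h2, h3, hAB.trans h4⟩

theorem IsSliceSmall.iUnion {A : ℕ → Set X} (h : ∀ i, IsSliceSmall T Z (A i)) :
    IsSliceSmall T Z (⋃ i, A i) := by
  choose W h1 h2 h3 h4 using h
  refine ⟨fun k => W k.unpair.1 k.unpair.2, fun k => h1 _ _, fun k => h2 _ _, fun k => h3 _ _, ?_⟩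
  refine iUnion_subset fun i x hx => ?_
  obtain ⟨j, hj⟩ := mem_iUnion.1 (h4 i hx)
  exact mem_iUnion.2 ⟨Nat.pair i j, by simpa using hj⟩

theorem IsSliceSmall.empty (hpos : 0 < packingEntropy T Z) : IsSliceSmall T Z ∅ :=
  ⟨fun _ => ∅, fun _ => analyticSet_empty, fun _ => empty_subset _,
    fun _ => packingEntropy_empty (T := T) ▸ hpos, empty_subset _⟩

theorem IsSliceSmall.sUnion (hpos : 0 < packingEntropy T Z) {S : Set (Set X)} (hS : S.Countable)
    (h : ∀ A ∈ S, IsSliceSmall T Z A) : IsSliceSmall T Z (⋃₀ S) := by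
  rcases S.eq_empty_or_nonempty with rfl | hne
  · simpa using IsSliceSmall.empty hpos
  · obtain ⟨A, rfl⟩ := hS.exists_eq_range hne
    rw [sUnion_range]
    exact .iUnion fun i => h _ (mem_range_self i)

theorem IsSliceSmall.union (h : IsSliceSmall T Z A) (h' : IsSliceSmall T Z B) :
    IsSliceSmall T Z (A ∪ B) := by
  refine (IsSliceSmall.iUnion (A := fun i : ℕ => if i = 0 then A else B) fun i => ?_).mono ?_
  · split_ifs <;> assumption
  · exact union_subset (subset_iUnion_of_subset 0 (by simp)) (subset_iUnion_of_subset 1 (by simp))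

theorem not_isSliceSmall_self (h : ¬HasIncreasingCountableSlice T Z) : ¬IsSliceSmall T Z Z := by
  rintro ⟨W, h1, h2, h3, h4⟩
  exact h ⟨W, h1, h4.antisymm (iUnion_subset h2), h3⟩

theorem le_packingEntropy_of_not_isSliceSmall (hA : AnalyticSet A) (hAZ : A ⊆ Z)
    (h : ¬IsSliceSmall T Z A) : packingEntropy T Z ≤ packingEntropy T A := by
  by_contra! hlt
  exact h ⟨fun _ => A, fun _ => hA, fun _ => hAZ, fun _ => hlt, subset_iUnion_of_subset 0 le_rfl⟩

/-- Removing the negligible basic open sets from a parametrization of `Z` by a Polish space leaves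
a nonempty Polish space all of whose nonempty open subsets have images of full packing entropy. -/
theorem exists_parametrization_packingEntropy_le {g : (ℕ → ℕ) → X} (hg : Continuous g)
    (hpos : 0 < packingEntropy T (range g)) (h : ¬HasIncreasingCountableSlice T (range g)) :
    ∃ Y : Set (ℕ → ℕ), IsClosed Y ∧ Y.Nonempty ∧ ∀ O : Set (ℕ → ℕ), IsOpen O →
      (O ∩ Y).Nonempty → packingEntropy T (range g) ≤ packingEntropy T (g '' (O ∩ Y)) := by
  have hself := not_isSliceSmall_self h
  set S : Set (Set (ℕ → ℕ)) :=
    {b | b ∈ TopologicalSpace.countableBasis (ℕ → ℕ) ∧ IsSliceSmall T (range g) (g '' b)} with hS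
  have hSc : S.Countable := (TopologicalSpace.countable_countableBasis _).mono fun b hb => hb.1
  have hbasis := TopologicalSpace.isBasis_countableBasis (ℕ → ℕ)
  have hsmall : IsSliceSmall T (range g) (g '' ⋃₀ S) := by
    refine (IsSliceSmall.sUnion hpos (hSc.image fun b => g '' b) ?_).mono (image_sUnion ▸ le_rfl)
    rintro _ ⟨b, hb, rfl⟩
    exact hb.2
  have hclosed : IsClosed (⋃₀ S)ᶜ := (isOpen_sUnion fun b hb => hbasis.isOpen hb.1).isClosed_compl
  refine ⟨(⋃₀ S)ᶜ, hclosed, ?_, ?_⟩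
  · by_contra hne
    rw [not_nonempty_iff_eq_empty, compl_empty_iff] at hne
    rw [hne, image_univ] at hsmall
    exact hself hsmall
  · rintro O hO ⟨y, hyO, hyS⟩
    obtain ⟨b, hb, hyb, hbO⟩ := hbasis.exists_subset_of_mem_open hyO hO
    have hbS : ¬IsSliceSmall T (range g) (g '' (b ∩ (⋃₀ S)ᶜ)) := by
      intro hbs
      refine hyS ⟨b, ⟨hb, (hbs.union hsmall).mono ?_⟩, hyb⟩
      rw [← image_union]
      exact image_mono fun z hz => (em (z ∈ ⋃₀ S)).elim Or.inr fun hz' => Or.inl ⟨hz, hz'⟩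
    refine le_packingEntropy_of_not_isSliceSmall ?_ (image_subset_range _ _)
      fun hOs => hbS (hOs.mono (image_mono (inter_subset_inter_left _ hbO)))
    borelize (ℕ → ℕ)
    exact (hO.measurableSet.inter hclosed.measurableSet).analyticSet.image_of_continuous hg

end Slice

section Existence

variable {X : Type*} [MetricSpace X] [CompactSpace X] [MeasurableSpace X] [BorelSpace X]
  {T : X → X}

/-- In an `h`-expansive system, an analytic set of positive packing entropy without increasing
countable slice has a measure of maximal packing entropy. -/
theorem hasMaxPackingEntropyMeasure_of_not_hasIncreasingCountableSlice (hT : Continuous T)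
    (hexp : IsHExpansive T) {Z : Set X} (hZ : AnalyticSet Z) (hpos : 0 < packingEntropy T Z)
    (h : ¬HasIncreasingCountableSlice T Z) : HasMaxPackingEntropyMeasure T Z := by
  classical
  obtain ⟨ε, hε, hstar⟩ := hexp
  have hat := packingEntropy_eq_packingEntropyAt hT hε hstar
  rw [AnalyticSet] at hZ
  rcases hZ with rfl | ⟨g, hg, rfl⟩
  · exact absurd packingEntropy_empty hpos.ne'
  obtain ⟨Y, hYc, hYne, hY⟩ := exists_parametrization_packingEntropy_le hg hpos h
  set E := packingEntropy T (range g) with hE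
  obtain ⟨u, humono, hu, hulim⟩ := exists_seq_strictMono_tendsto' hpos
  have hucoe : ∀ p, ((u p).toNNReal : ℝ≥0∞) = u p :=
    fun p => ENNReal.coe_toNNReal (hu p).2.ne_top
  have : PolishSpace Y := hYc.polishSpace
  let := TopologicalSpace.upgradeIsCompletelyMetrizable Y
  have : Nonempty Y := hYne.to_subtype
  obtain ⟨μ, hμ, hμr, hμs⟩ := exists_measure_le_localUpperEntropy (T := T)
    (f := fun y : Y => g y) (s := fun p => (u p).toNNReal) hT (hg.comp continuous_subtype_val)
    (half_pos hε) (fun p q hpq => ENNReal.toNNReal_mono (hu q).2.ne_top (humono.monotone hpq)) (by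
      rintro V hV ⟨y, hyV⟩ p N
      obtain ⟨O, hO, rfl⟩ := isOpen_induced_iff.1 hV
      have hlarge : ((u p).toNNReal : ℝ≥0∞) < packingEntropyAt T (g '' (O ∩ Y)) (ε / 2) := by
        rw [hucoe, ← hat]
        exact (hu p).2.trans_le (hY O hO ⟨y, hyV, y.2⟩)
      have hgrow : ¬PackingGrowth T (g '' (O ∩ Y)) (u p).toNNReal (ε / 2) := fun hg' =>
        absurd (packingEntropyAt_le_of_cover (W := fun _ => g '' (O ∩ Y))
          (subset_iUnion_of_subset 0 le_rfl) fun _ => hg') (not_le.2 hlarge)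
      simp only [PackingGrowth, not_exists, not_forall, not_le] at hgrow
      obtain ⟨n, hn, F, hF, hFd, hFc⟩ := hgrow 1 N
      have hlift : ∀ x : F, ∃ y : Y, (y : ℕ → ℕ) ∈ O ∧ g y = x := by
        rintro ⟨x, hx⟩
        obtain ⟨y, hy, hyx⟩ := hF hx
        exact ⟨⟨y, hy.2⟩, hy.1, hyx⟩
      choose c hcO hc using hlift
      have hcinj : Function.Injective c := fun x x' hxx' =>
        Subtype.ext (by rw [← hc x, ← hc x', hxx'])
      refine ⟨n, hn, F.attach.image c, ?_, ?_, ?_⟩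
      · intro z hz
        obtain ⟨x, -, rfl⟩ := Finset.mem_image.1 (Finset.mem_coe.1 hz)
        exact hcO x
      · rw [Finset.card_image_of_injective _ hcinj, Finset.card_attach]
        simpa using hFc.le
      · intro a ha b hb hab
        obtain ⟨x, -, rfl⟩ := Finset.mem_image.1 ha
        obtain ⟨x', -, rfl⟩ := Finset.mem_image.1 hb
        have hxx' : (x : X) ≠ x' := fun heq => hab (congrArg c (Subtype.ext heq))
        by_contra! hclose
        simp only [hc] at hclose
        have hmem : (x' : X) ∈ closedBowenBall T n (x : X) (ε / 2) := hclose
        refine disjoint_left.1 (hFd x.2 x'.2 hxx') hmem fun k _ => ?_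
        rw [dist_self]
        positivity)
  have hμZ : μ (range g) = 1 := by
    refine le_antisymm prob_le_one (hμr ▸ measure_mono ?_)
    rintro _ ⟨y, rfl⟩
    exact mem_range_self _
  refine ⟨μ, hμ, hμZ, le_antisymm ?_ ?_, hpos⟩
  · have hle : ∀ᵐ x ∂μ, localUpperEntropy T μ x ≤ E := by
      refine ae_of_measure_inter_eq_zero hμZ
        (measurableSet_le (measurable_localUpperEntropy hT μ) measurable_const) ?_
      simpa only [not_le] using measure_packingEntropy_lt_localUpperEntropy T μ (range g)
    calc upperEntropy T μ ≤ ∫⁻ _, E ∂μ := lintegral_mono_ae hle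
      _ = E := by simp
  · calc E = ∫⁻ _, E ∂μ := by simp
      _ ≤ upperEntropy T μ := lintegral_mono_ae (hμs.mono fun x hx =>
          le_of_tendsto' hulim fun p => hucoe p ▸ hx p)

end Existence

theorem mainTheorem3 {X : Type*} [MetricSpace X] [CompactSpace X] [MeasurableSpace X]
    [BorelSpace X] (T : X → X) (hT : Continuous T) (Z : Set X) (hZ : AnalyticSet Z)
    (hpos : 0 < packingEntropy T Z) :
    (packingEntropy T Z < ⊤ →
      HasMaxPackingEntropyMeasure T Z → ¬ HasIncreasingCountableSlice T Z) ∧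
    (IsHExpansive T →
      (HasMaxPackingEntropyMeasure T Z ↔ ¬ HasIncreasingCountableSlice T Z)) := by
  refine ⟨fun hfin h => h.not_hasIncreasingCountableSlice hT hfin, fun hexp => ⟨fun h => ?_,
    hasMaxPackingEntropyMeasure_of_not_hasIncreasingCountableSlice hT hexp hZ hpos⟩⟩
  obtain ⟨ε, hε, hstar⟩ := hexp
  refine h.not_hasIncreasingCountableSlice hT ?_
  rw [packingEntropy_eq_packingEntropyAt hT hε hstar]
  exact packingEntropyAt_lt_top T (half_pos hε) Z
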